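/- \textbf{Definitions.} A \emph{forest algebra} $(H,V)$ consists of a commutative monoid $(H,+,0)$, a monoid $(V,\cdot,1)$ and a faithful right action of $V$ on $H$ such that for all $v\in V$, $h\in H$ there is $v+h\in V$ with $g(v+h)=gv+h$ for all $g\in H$. If $H$ is idempotent and commutative, then $H$ acting on itself by addition is a forest algebra $(H,H)$; such forest algebras are called \emph{flat idempotent and commutative}. A \emph{forest category} ${\cal C}$ consists of: \begin{itemize} \item a category with a finite set ${\bf Obj}({\cal C})$ of objects and sets of arrows ${\bf Arr}(x,y)$, where composition is written from left to right, ${\bf Arr}(x,y)\times{\bf Arr}(y,z)\to{\bf Arr}(x,z)$, and $1_x$ is the identity at $x$; \item a commutative monoid structure $(+,0)$ on ${\bf Obj}({\cal C})$; \item a commutative monoid ${\bf HArr}({\cal C})$ of \emph{half-arrows} with a surjective monoid homomorphism $end:{\bf HArr}({\cal C})\to{\bf Obj}({\cal C})$; write ${\bf HArr}(x)=end^{-1}(x)$; \item an action ${\bf HArr}(x)\times{\bf Arr}(x,y)\to{\bf HArr}(y)$, $(r,u)\mapsto ru$, with $(ru)v=r(uv)$ and $r1_x=r$, that is faithful: if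 $u,u'\in{\bf Arr}(x,y)$ and $ru=ru'$ for all $r\in{\bf HArr}(x)$, then $u=u'$; \item for all $u\in{\bf Arr}(x,y)$ and $s\in{\bf HArr}(z)$ an arrow $u+s\in{\bf Arr}(x,y+z)$ such that $r(u+s)=ru+s$ for $r\in{\bf HArr}(x)$, $v(u+s)=vu+s$ for arrows $v$ ending at $x$, and $(u+s)+s'=u+(s+s')$ for all half-arrows $s'$. \end{itemize} It is \emph{finite} if its sets of arrows and half-arrows are finite. ${\cal C}$ \emph{divides} a forest algebra $(H,V)$ if one can assign to each half-arrow $r$ a nonempty set $K_r\subseteq H$ and to each arrow $u$ a nonempty set $K_u\subseteq V$ such that $K_uK_v\subseteq K_{uv}$ and $K_rK_u\subseteq K_{ru}$ whenever $uv$, resp. $ru$, is defined; $K_r+K_s\subseteq K_{r+s}$ and $K_u+K_r\subseteq K_{u+r}$ for all half-arrows $r,s$ and arrows $u$; and $K_u\cap K_{u'}=\emptyset$ for distinct $u,u'\in{\bf Arr}(x,y)$, and $K_r\cap K_{r'}=\emptyset$ for distinct $r,r'\in{\bf HArr}(x)$. \textbf{Theorem.} Let ${\cal C}$ be a finite forest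 category in which $x+x=x$ for all objects $x$. Then ${\cal C}$ divides some flat idempotent and commutative forest algebra if and only if the following three conditions hold: \begin{enumerate} \item (Loop removal) $rst_1+rst_2=rt_1+rst_2$ for all objects $y,z_1,z_2$ and all $r\in{\bf HArr}(y)$, $s\in{\bf Arr}(y,y)$, $t_1\in{\bf Arr}(y,z_1)$, $t_2\in{\bf Arr}(y,z_2)$. \item (Horizontal absorption) $(r+s)t+ru=st+ru$ for all objects $x,y,z,z'$ and all $r\in{\bf HArr}(x)$, $s\in{\bf HArr}(x+y)$, $t\in{\bf Arr}(x+y,z)$, $u\in{\bf Arr}(x,z')$. \item (Horizontal idempotence) $r=r+r$ for all half-arrows $r$. \end{enumerate} -/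

import Mathlib

universe w u₁ u₂ u₃

/-- A forest algebra `(H, V)` with commutative horizontal monoid: `H` is written additively, `V`
multiplicatively, `act h v` is the right action `h v`, and `ins v h` is the element `v + h` of `V`. -/
structure ForestAlgebra (H V : Type*) [AddCommMonoid H] [Monoid V] where
  act : H → V → H
  act_one : ∀ h, act h 1 = h
  act_mul : ∀ h v w, act h (v * w) = act (act h v) w
  faithful : ∀ v w, (∀ h, act h v = act h w) → v = w
  ins : V → H → V
  act_ins : ∀ g v h, act g (ins v h) = act g v + h

/-- The flat forest algebra `(H, H)`: the commutative monoid `H` acting on itself by addition. -/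
def ForestAlgebra.flat (H : Type*) [AddCommMonoid H] : ForestAlgebra H (Multiplicative H) where
  act h v := h + v.toAdd
  act_one h := by simp
  act_mul h v w := by simp [add_assoc]
  faithful v w hvw := by
    have h0 := hvw 0
    simp only [zero_add] at h0
    exact Multiplicative.toAdd.injective h0
  ins v h := Multiplicative.ofAdd (v.toAdd + h)
  act_ins g v h := by simp [add_assoc]

/-- A forest category with commutative monoid of objects `Obj`, commutative monoid of half-arrows
`HArr` and set of arrows `Arr`. The hom-sets are the fibres of `start`, `target` and `hend`; the
operations that are only defined when endpoints match take a proof that they do. -/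
structure ForestCategory (Obj HArr Arr : Type*) [AddCommMonoid Obj] [AddCommMonoid HArr] where
  finite_obj : Finite Obj
  start : Arr → Obj
  target : Arr → Obj
  /-- the end object of a half-arrow -/
  hend : HArr →+ Obj
  hend_surjective : Function.Surjective hend
  /-- composition of arrows, in diagrammatic order: first `u`, then `v` -/
  comp : (u v : Arr) → target u = start v → Arr
  start_comp : ∀ u v h, start (comp u v h) = start u
  target_comp : ∀ u v h, target (comp u v h) = target v
  comp_assoc : ∀ u v w (huv : target u = start v) (hvw : target v = start w),
    comp (comp u v huv) w ((target_comp u v huv).trans hvw)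
      = comp u (comp v w hvw) (huv.trans (start_comp v w hvw).symm)
  /-- the identity arrow at an object -/
  one : Obj → Arr
  start_one : ∀ x, start (one x) = x
  target_one : ∀ x, target (one x) = x
  comp_one : ∀ u, comp u (one (target u)) (start_one (target u)).symm = u
  one_comp : ∀ u, comp (one (start u)) u (target_one (start u)) = u
  /-- the action of an arrow on a half-arrow -/
  act : (r : HArr) → (u : Arr) → hend r = start u → HArr
  hend_act : ∀ r u h, hend (act r u h) = target u
  act_comp : ∀ r u v (hru : hend r = start u) (huv : target u = start v),
    act (act r u hru) v ((hend_act r u hru).trans huv)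
      = act r (comp u v huv) (hru.trans (start_comp u v huv).symm)
  act_one : ∀ r, act r (one (hend r)) (start_one (hend r)).symm = r
  faithful : ∀ u v (hs : start u = start v), target u = target v →
    (∀ r (h : hend r = start u), act r u h = act r v (h.trans hs)) → u = v
  /-- the arrow `u + r` obtained by inserting the half-arrow `r` beside the arrow `u` -/
  ins : Arr → HArr → Arr
  start_ins : ∀ u r, start (ins u r) = start u
  target_ins : ∀ u r, target (ins u r) = target u + hend r
  act_ins : ∀ r u s (h : hend r = start u),
    act r (ins u s) (h.trans (start_ins u s).symm) = act r u h + s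
  comp_ins : ∀ u v s (h : target u = start v),
    comp u (ins v s) (h.trans (start_ins v s).symm) = ins (comp u v h) s
  ins_ins : ∀ u r s, ins (ins u r) s = ins u (r + s)

namespace ForestCategory

section

variable {Obj HArr Arr : Type*} [AddCommMonoid Obj] [AddCommMonoid HArr]

/-- A division of a forest category by the forest algebra `(H, V)`: each half-arrow `r` is covered
by the elements of a nonempty set `K r ⊆ H` and each arrow `u` by those of a nonempty set
`L u ⊆ V`, compatibly with the operations, and coterminal (half-)arrows are covered by disjoint
sets. -/
structure IsDivision (C : ForestCategory Obj HArr Arr) {H V : Type*} [AddCommMonoid H] [Monoid V]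
    (A : ForestAlgebra H V) (K : HArr → Set H) (L : Arr → Set V) : Prop where
  nonempty_harr : ∀ r, (K r).Nonempty
  nonempty_arr : ∀ u, (L u).Nonempty
  mul_mem : ∀ u v (h : C.target u = C.start v), ∀ a ∈ L u, ∀ b ∈ L v, a * b ∈ L (C.comp u v h)
  act_mem : ∀ r u (h : C.hend r = C.start u), ∀ k ∈ K r, ∀ a ∈ L u, A.act k a ∈ K (C.act r u h)
  add_mem : ∀ r s, ∀ k ∈ K r, ∀ l ∈ K s, k + l ∈ K (r + s)
  ins_mem : ∀ r u, ∀ k ∈ K r, ∀ a ∈ L u, A.ins a k ∈ L (C.ins u r)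
  disjoint_arr : ∀ u v, C.start u = C.start v → C.target u = C.target v → u ≠ v →
    Disjoint (L u) (L v)
  disjoint_harr : ∀ r s, C.hend r = C.hend s → r ≠ s → Disjoint (K r) (K s)

/-- `C` divides the forest algebra `A = (H, V)`. -/
def Divides (C : ForestCategory Obj HArr Arr) {H V : Type*} [AddCommMonoid H] [Monoid V]
    (A : ForestAlgebra H V) : Prop :=
  ∃ (K : HArr → Set H) (L : Arr → Set V), C.IsDivision A K L

/-- Loop removal: `r s t₁ + r s t₂ = r t₁ + r s t₂` for every half-arrow `r` to an object `y`,
every arrow `s` from `y` to `y`, and all arrows `t₁, t₂` starting at `y`. -/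
def LoopRemoval (C : ForestCategory Obj HArr Arr) : Prop :=
  ∀ (y : Obj) (r : HArr) (s t₁ t₂ : Arr) (hr : C.hend r = y)
    (hs : C.start s = y) (hs' : C.target s = y) (h₁ : C.start t₁ = y) (h₂ : C.start t₂ = y),
    C.act (C.act r s (hr.trans hs.symm)) t₁ ((C.hend_act _ _ _).trans (hs'.trans h₁.symm))
      + C.act (C.act r s (hr.trans hs.symm)) t₂ ((C.hend_act _ _ _).trans (hs'.trans h₂.symm))
    = C.act r t₁ (hr.trans h₁.symm)
      + C.act (C.act r s (hr.trans hs.symm)) t₂ ((C.hend_act _ _ _).trans (hs'.trans h₂.symm))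

/-- If `r` ends at `x` and `s` ends at `x + y`, and objects are idempotent, then `r + s` ends at
`x + y`. -/
theorem hend_add_of_idempotent (C : ForestCategory Obj HArr Arr) (hO : ∀ x : Obj, x + x = x)
    {x y : Obj} {r s : HArr} (hr : C.hend r = x) (hs : C.hend s = x + y) :
    C.hend (r + s) = x + y := by
  rw [map_add, hr, hs, ← add_assoc, hO]

/-- Horizontal absorption: `(r + s) t + r u = s t + r u` for every half-arrow `r` to an object
`x`, every half-arrow `s` to an object of the form `x + y`, every arrow `t` starting at `x + y`,
and every arrow `u` starting at `x`. Objects are assumed idempotent, which makes `(r + s) t`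
defined. -/
def HorizontalAbsorption (C : ForestCategory Obj HArr Arr) (hO : ∀ x : Obj, x + x = x) : Prop :=
  ∀ (x y : Obj) (r s : HArr) (t u : Arr) (hr : C.hend r = x) (hs : C.hend s = x + y)
    (ht : C.start t = x + y) (hu : C.start u = x),
    C.act (r + s) t ((C.hend_add_of_idempotent hO hr hs).trans ht.symm)
      + C.act r u (hr.trans hu.symm)
    = C.act s t (hs.trans ht.symm) + C.act r u (hr.trans hu.symm)

end

/-- `C` divides a flat idempotent and commutative forest algebra. -/
def GloballyIdempotentCommutative {Obj : Type u₁} {HArr : Type u₂} {Arr : Type u₃}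
    [AddCommMonoid Obj] [AddCommMonoid HArr] (C : ForestCategory Obj HArr Arr) : Prop :=
  ∃ (H : Type w) (_ : AddCommMonoid H), (∀ h : H, h + h = h) ∧ C.Divides (ForestAlgebra.flat H)

/-- Horizontal idempotence: `r = r + r` for every half-arrow `r`. -/
def HorizontalIdempotence {Obj HArr Arr : Type*} [AddCommMonoid Obj] [AddCommMonoid HArr]
    (_C : ForestCategory Obj HArr Arr) : Prop :=
  ∀ r : HArr, r = r + r

end ForestCategory

/-! Necessity: pick a cover of each item; in a flat idempotent algebra both sides of each identity
then get the same cover, and disjointness forces equality. Sufficiency: take for `H` the sets of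
labels under union, each half-arrow and arrow being a label, and cover a half-arrow by the contents
of all forests that evaluate to it. All closure properties are immediate; disjointness says that
forests with equal content and equal end have equal value (`HasContent.eq_of_hend_eq`). This follows
from `HasContent.add_act_add_eq`: if F + fv = F, then F + (G + f)v = F for every G built from labels
of F, by induction on G. -/

/-- Sets of labels, regarded as an idempotent commutative monoid under union. -/
def LabelSet (X : Type w) : Type w := Set X

instance (X : Type w) : Add (LabelSet X) := ⟨Set.union⟩

instance (X : Type w) : Zero (LabelSet X) := ⟨(∅ : Set X)⟩

instance (X : Type w) : AddCommMonoid (LabelSet X) where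
  add_assoc := Set.union_assoc
  zero_add := Set.empty_union
  add_zero := Set.union_empty
  add_comm := Set.union_comm
  nsmul := nsmulRec

theorem LabelSet.add_self {X : Type w} (a : LabelSet X) : a + a = a := Set.union_self a

namespace LabelSet

variable {X : Type w}

instance : Membership X (LabelSet X) := ⟨fun a x => Set.Mem a x⟩

/-- The set with a single label. -/
def single (x : X) : LabelSet X := ({x} : Set X)

theorem mem_single {x y : X} : x ∈ single y ↔ x = y := Iff.rfl

theorem mem_add {x : X} {a b : LabelSet X} : x ∈ a + b ↔ x ∈ a ∨ x ∈ b := Iff.rfl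

end LabelSet

namespace ForestCategory

/-! ### Necessity of the three identities -/

section Forward

variable {Obj : Type u₁} {HArr : Type u₂} {Arr : Type u₃} [AddCommMonoid Obj] [AddCommMonoid HArr]
  {C : ForestCategory Obj HArr Arr}

/-- Carries identities of `H` back to `C`: one common cover suffices. -/
theorem IsDivision.eq_of_mem {H V : Type*} [AddCommMonoid H] [Monoid V] {A : ForestAlgebra H V}
    {K : HArr → Set H} {L : Arr → Set V} (hD : C.IsDivision A K L) {r s : HArr} {k : H}
    (h : C.hend r = C.hend s) (hr : k ∈ K r) (hs : k ∈ K s) : r = s := by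
  by_contra hne
  exact Set.disjoint_left.mp (hD.disjoint_harr r s h hne) hr hs

variable {H : Type w} [AddCommMonoid H] {K : HArr → Set H} {L : Arr → Set (Multiplicative H)}

theorem IsDivision.loopRemoval (hH : ∀ h : H, h + h = h)
    (hD : C.IsDivision (ForestAlgebra.flat H) K L) : C.LoopRemoval := by
  intro y r s t₁ t₂ hr hs hs' h₁ h₂
  obtain ⟨k, hk⟩ := hD.nonempty_harr r
  obtain ⟨a, ha⟩ := hD.nonempty_arr s
  obtain ⟨b₁, hb₁⟩ := hD.nonempty_arr t₁
  obtain ⟨b₂, hb₂⟩ := hD.nonempty_arr t₂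
  have hrs := hD.act_mem r s (hr.trans hs.symm) k hk a ha
  have hst₁ := hD.act_mem _ t₁ ((C.hend_act _ _ _).trans (hs'.trans h₁.symm)) _ hrs b₁ hb₁
  have hst₂ := hD.act_mem _ t₂ ((C.hend_act _ _ _).trans (hs'.trans h₂.symm)) _ hrs b₂ hb₂
  have ht₁ := hD.act_mem r t₁ (hr.trans h₁.symm) k hk b₁ hb₁
  refine hD.eq_of_mem (by simp only [map_add, C.hend_act]) (hD.add_mem _ _ _ hst₁ _ hst₂) ?_
  convert hD.add_mem _ _ _ ht₁ _ hst₂ using 1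
  change k + a.toAdd + b₁.toAdd + (k + a.toAdd + b₂.toAdd)
    = k + b₁.toAdd + (k + a.toAdd + b₂.toAdd)
  calc _ = (k + k) + (a.toAdd + a.toAdd) + b₁.toAdd + b₂.toAdd := by abel
    _ = (k + k) + a.toAdd + b₁.toAdd + b₂.toAdd := by rw [hH a.toAdd]
    _ = _ := by abel

theorem IsDivision.horizontalAbsorption (hO : ∀ x : Obj, x + x = x) (hH : ∀ h : H, h + h = h)
    (hD : C.IsDivision (ForestAlgebra.flat H) K L) : C.HorizontalAbsorption hO := by
  intro x y r s t u hr hs ht hu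
  obtain ⟨k, hk⟩ := hD.nonempty_harr r
  obtain ⟨l, hl⟩ := hD.nonempty_harr s
  obtain ⟨a, ha⟩ := hD.nonempty_arr t
  obtain ⟨b, hb⟩ := hD.nonempty_arr u
  have hrst := hD.act_mem (r + s) t ((C.hend_add_of_idempotent hO hr hs).trans ht.symm) _
    (hD.add_mem r s k hk l hl) a ha
  have hst := hD.act_mem s t (hs.trans ht.symm) l hl a ha
  have hru := hD.act_mem r u (hr.trans hu.symm) k hk b hb
  refine hD.eq_of_mem (by simp only [map_add, C.hend_act]) (hD.add_mem _ _ _ hrst _ hru) ?_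
  convert hD.add_mem _ _ _ hst _ hru using 1
  change k + l + a.toAdd + (k + b.toAdd) = l + a.toAdd + (k + b.toAdd)
  calc _ = (k + k) + l + a.toAdd + b.toAdd := by abel
    _ = k + l + a.toAdd + b.toAdd := by rw [hH k]
    _ = _ := by abel

theorem IsDivision.horizontalIdempotence (hO : ∀ x : Obj, x + x = x) (hH : ∀ h : H, h + h = h)
    (hD : C.IsDivision (ForestAlgebra.flat H) K L) : C.HorizontalIdempotence := by
  intro r
  obtain ⟨k, hk⟩ := hD.nonempty_harr r
  refine hD.eq_of_mem (by rw [map_add, hO]) hk ?_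
  convert hD.add_mem r r k hk k hk using 1
  exact (hH k).symm

end Forward

/-! ### Sufficiency: forests and their contents -/

section Content

variable {Obj : Type u₁} {HArr : Type u₂} {Arr : Type u₃} [AddCommMonoid Obj] [AddCommMonoid HArr]

/-- `C.HasContent i r c`: the half-arrow `r` is the value of a forest whose leaves are half-arrows
and whose inner nodes are arrows, the set of labels occurring in it (named through `i`)
being `c`. -/
inductive HasContent (C : ForestCategory Obj HArr Arr) {X : Type w} (i : HArr ⊕ Arr → X) :
    HArr → LabelSet X → Prop
  | leaf (r : HArr) : HasContent C i r (.single (i (.inl r)))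
  | act {r : HArr} {c : LabelSet X} (u : Arr) (h : C.hend r = C.start u) :
      HasContent C i r c → HasContent C i (C.act r u h) (c + .single (i (.inr u)))
  | add {r s : HArr} {c d : LabelSet X} :
      HasContent C i r c → HasContent C i s d → HasContent C i (r + s) (c + d)

variable {C : ForestCategory Obj HArr Arr}

theorem exists_act_eq_self (r : HArr) : ∃ u h, C.act r u h = r := ⟨_, _, C.act_one r⟩

theorem exists_act_eq_act (r : HArr) (u v : Arr) (h : C.hend r = C.start u)
    (h' : C.hend (C.act r u h) = C.start v) :
    ∃ w hw, C.act r w hw = C.act (C.act r u h) v h' :=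
  ⟨_, _, (C.act_comp r u v h ((C.hend_act r u h).symm.trans h')).symm⟩

theorem exists_act_eq_add (r : HArr) (u : Arr) (s : HArr) (h : C.hend r = C.start u) :
    ∃ w hw, C.act r w hw = C.act r u h + s :=
  ⟨_, _, C.act_ins r u s h⟩

variable {X : Type w} {i : HArr ⊕ Arr → X}

/-- Everything in the forest surrounding an occurrence of the leaf composes to a single arrow. -/
theorem HasContent.exists_act_of_leaf (hi : Function.Injective i) {F : HArr} {c : LabelSet X}
    (hF : C.HasContent i F c) {r : HArr} (hr : i (.inl r) ∈ c) : ∃ u h, C.act r u h = F := by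
  induction hF with
  | leaf s =>
    obtain rfl := Sum.inl.inj (hi (LabelSet.mem_single.mp hr))
    exact exists_act_eq_self _
  | act u h _ ih =>
    rcases LabelSet.mem_add.mp hr with hr | hr
    · obtain ⟨v, hv, rfl⟩ := ih hr
      exact exists_act_eq_act _ _ _ _ _
    · exact absurd (hi (LabelSet.mem_single.mp hr)) Sum.inl_ne_inr
  | add _ _ ih₁ ih₂ =>
    rcases LabelSet.mem_add.mp hr with hr | hr
    · obtain ⟨v, hv, rfl⟩ := ih₁ hr
      exact exists_act_eq_add _ _ _ _
    · obtain ⟨v, hv, rfl⟩ := ih₂ hr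
      rw [add_comm]
      exact exists_act_eq_add _ _ _ _

theorem HasContent.exists_act_of_node (hi : Function.Injective i) {F : HArr} {c : LabelSet X}
    (hF : C.HasContent i F c) {t : Arr} (ht : i (.inr t) ∈ c) :
    ∃ g hg u hu, C.act (C.act g t hg) u hu = F := by
  induction hF with
  | leaf s => exact absurd (hi (LabelSet.mem_single.mp ht)) Sum.inr_ne_inl
  | @act r _ u h _ ih =>
    rcases LabelSet.mem_add.mp ht with ht | ht
    · obtain ⟨g, hg, v, hv, rfl⟩ := ih ht
      exact ⟨g, hg, exists_act_eq_act _ _ _ _ _⟩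
    · obtain rfl := Sum.inr.inj (hi (LabelSet.mem_single.mp ht))
      exact ⟨r, h, exists_act_eq_self _⟩
  | add _ _ ih₁ ih₂ =>
    rcases LabelSet.mem_add.mp ht with ht | ht
    · obtain ⟨g, hg, v, hv, rfl⟩ := ih₁ ht
      exact ⟨g, hg, exists_act_eq_add _ _ _ _⟩
    · obtain ⟨g, hg, v, hv, rfl⟩ := ih₂ ht
      rw [add_comm]
      exact ⟨g, hg, exists_act_eq_add _ _ _ _⟩

/-- The context `a ↦ (a + f) v`, as an arrow. -/
theorem exists_act_eq_act_add {z : Obj} (f : HArr) (v : Arr) (hz : z + C.hend f = C.start v) :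
    ∃ w, ∃ hw : z = C.start w, ∀ (a : HArr) (ha : C.hend a = z), C.act a w (ha.trans hw)
      = C.act (a + f) v (by rw [map_add, ha, hz]) := by
  refine ⟨C.comp (C.ins (C.one z) f) v (by rw [C.target_ins, C.target_one, hz]), by
    rw [C.start_comp, C.start_ins, C.start_one], ?_⟩
  rintro a rfl
  rw [← C.act_comp a _ v (by rw [C.start_ins, C.start_one])]
  congr 1
  rw [C.act_ins a _ f (C.start_one _).symm, C.act_one]

/-- Adding g at the object of r is a loop, namely the arrow 1 + g, since objects are idempotent. -/
theorem LoopRemoval.act_add (hL : C.LoopRemoval) (hO : ∀ x : Obj, x + x = x) {r g : HArr}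
    (hg : C.hend g = C.hend r) (t₁ t₂ : Arr) (h₁ : C.hend r = C.start t₁)
    (h₂ : C.hend r = C.start t₂) (h₁' : C.hend (r + g) = C.start t₁)
    (h₂' : C.hend (r + g) = C.start t₂) :
    C.act (r + g) t₁ h₁' + C.act (r + g) t₂ h₂' = C.act r t₁ h₁ + C.act (r + g) t₂ h₂' := by
  have hs : C.start (C.ins (C.one (C.hend r)) g) = C.hend r := by rw [C.start_ins, C.start_one]
  have key := hL (C.hend r) r (C.ins (C.one (C.hend r)) g) t₁ t₂ rfl hs
    (by rw [C.target_ins, C.target_one, hg, hO]) h₁.symm h₂.symm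
  have e : C.act r (C.ins (C.one (C.hend r)) g) hs.symm = r + g := by
    rw [C.act_ins r _ g (C.start_one _).symm, C.act_one]
  simpa only [e] using key

theorem HorizontalAbsorption.act_add {hO : ∀ x : Obj, x + x = x} (hA : C.HorizontalAbsorption hO)
    {r f : HArr} {u v : Arr} (hle : C.hend r + C.hend f = C.hend f) (hu : C.hend r = C.start u)
    (hv : C.hend f = C.start v) :
    C.act (r + f) v (by rw [map_add, hle, hv]) + C.act r u hu = C.act f v hv + C.act r u hu :=
  hA (C.hend r) (C.hend f) r f v u rfl hle.symm (hv.symm.trans hle.symm) hu.symm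

/-- A forest `G` all of whose labels occur in `F` may be added inside any context which `F`
absorbs. -/
theorem HasContent.add_act_add_eq (hO : ∀ x : Obj, x + x = x) (hL : C.LoopRemoval)
    (hA : C.HorizontalAbsorption hO) (hI : C.HorizontalIdempotence) (hi : Function.Injective i)
    {F : HArr} {c : LabelSet X} (hF : C.HasContent i F c)
    {G : HArr} {d : LabelSet X} (hG : C.HasContent i G d) (hdc : ∀ x ∈ d, x ∈ c)
    (f : HArr) (v : Arr) (hv : C.hend f = C.start v) (hle : C.hend G + C.hend f = C.hend f)
    (hfv : F + C.act f v hv = F) :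
    F + C.act (G + f) v (by rw [map_add, hle, hv]) = F := by
  induction hG generalizing f v with
  | leaf r =>
    -- Here F = ru, so horizontal absorption deletes r from (r + f)v in the presence of F.
    obtain ⟨u, hu, hru⟩ := hF.exists_act_of_leaf hi (hdc _ rfl)
    have := hA.act_add hle hu hv
    rw [hru] at this
    rw [add_comm, this, add_comm, hfv]
  | @add r s _ _ _ _ ihr ihs =>
    rw [map_add] at hle
    -- Objects form a semilattice, so both summands lie below the end of f.
    have hs : C.hend s + C.hend f = C.hend f := by
      rw [← hle, ← add_assoc, add_left_comm, hO]
    have hr : C.hend r + C.hend f = C.hend f := by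
      rw [← hle, ← add_assoc, ← add_assoc, hO]
    have hsf : C.hend (s + f) = C.hend f := by rw [map_add, hs]
    -- Insert s beside f, then r beside s + f.
    have := ihr (fun x hx => hdc x (LabelSet.mem_add.mpr (.inl hx))) (s + f) v (hsf.trans hv)
      (by rw [hsf, hr]) (ihs (fun x hx => hdc x (LabelSet.mem_add.mpr (.inr hx))) f v hv hs hfv)
    simpa only [add_assoc] using this
  | @act r _ t h _ ih =>
    obtain ⟨g, hg, u, hu, hgu⟩ :=
      hF.exists_act_of_node hi (hdc _ (LabelSet.mem_add.mpr (.inr rfl)))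
    have hgr : C.hend g = C.hend r := hg.trans h.symm
    have htu : C.target t = C.start u := (C.hend_act g t hg).symm.trans hu
    have hrg : C.hend (r + g) = C.start t := by rw [map_add, hgr, hO, h]
    -- Since F = gtu and F + F = F, the induction hypothesis for r, with g and tu as context, gives
    -- F + (r + g)tu = F.
    have hF₁ : F + C.act (C.act (r + g) t hrg) u ((C.hend_act _ _ _).trans htu) = F := by
      rw [C.act_comp _ t u hrg htu]
      refine ih (fun x hx => hdc x (LabelSet.mem_add.mpr (.inl hx))) g (C.comp t u htu)
        (by rw [C.start_comp, hg])
        (by rw [hgr, hO]) ?_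
      rw [← C.act_comp g t u hg htu, hgu]
      exact (hI F).symm
    have hzf : C.target t + C.hend f = C.hend f := by rw [← C.hend_act r t h, hle]
    -- w is the context a ↦ (a + f)v.
    obtain ⟨w, hw, hwa⟩ := exists_act_eq_act_add f v (hzf.trans hv)
    -- In the presence of (r + g)tu, loop removal exchanges (rt + f)v for ((r + g)t + f)v.
    have loop := hL.act_add hO hgr (C.comp t w hw) (C.comp t u htu)
      (by rw [C.start_comp, h]) (by rw [C.start_comp, h]) (by rw [C.start_comp, hrg])
      (by rw [C.start_comp, hrg])
    rw [← C.act_comp _ t w hrg hw, ← C.act_comp _ t w h hw, ← C.act_comp _ t u hrg htu,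
      hwa _ (C.hend_act _ _ _), hwa _ (C.hend_act _ _ _)] at loop
    -- In the same presence, horizontal absorption reduces ((r + g)t + f)v to fv, which F absorbs.
    have abs := hA.act_add (r := C.act (r + g) t hrg) (f := f) (u := u) (v := v)
      (by rw [C.hend_act, hzf]) ((C.hend_act _ _ _).trans htu) hv
    rw [abs] at loop
    calc _ = F + (C.act (C.act r t h + f) v _
          + C.act (C.act (r + g) t hrg) u ((C.hend_act _ _ _).trans htu)) := by
          rw [add_left_comm, hF₁, add_comm]
      _ = F + (C.act f v hv
          + C.act (C.act (r + g) t hrg) u ((C.hend_act _ _ _).trans htu)) := by rw [← loop]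
      _ = F := by rw [← add_assoc, hfv, hF₁]

/-- Equal contents let each forest absorb the other, so both equal F + G. -/
theorem HasContent.eq_of_hend_eq (hO : ∀ x : Obj, x + x = x) (hL : C.LoopRemoval)
    (hA : C.HorizontalAbsorption hO) (hI : C.HorizontalIdempotence) (hi : Function.Injective i)
    {F G : HArr} {c : LabelSet X} (hF : C.HasContent i F c) (hG : C.HasContent i G c)
    (h : C.hend F = C.hend G) : F = G := by
  have absorb : ∀ {F G : HArr}, C.HasContent i F c → C.HasContent i G c → C.hend F = C.hend G →
      G + F = F := by
    intro F G hF hG h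
    have hGF : C.hend (G + F) = C.hend F := by rw [map_add, ← h, hO]
    -- The starting context is F itself with the identity arrow, absorbed because F + F = F.
    have := hF.add_act_add_eq hO hL hA hI hi hG (fun _ hx => hx) F (C.one (C.hend F))
      (C.start_one _).symm (by rw [← h, hO]) (by rw [C.act_one, ← hI])
    simp only [← hGF, C.act_one] at this
    rwa [add_left_comm, ← hI] at this
  rw [← absorb hF hG h, add_comm, absorb hG hF h.symm]

/-- The sets of contents of the half-arrows form a division by a flat forest algebra. -/
theorem isDivision_hasContent (hO : ∀ x : Obj, x + x = x) (hL : C.LoopRemoval)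
    (hA : C.HorizontalAbsorption hO) (hI : C.HorizontalIdempotence) (hi : Function.Injective i) :
    C.IsDivision (ForestAlgebra.flat (LabelSet X)) (fun r => {c | C.HasContent i r c})
      (fun u => {a | ∀ r c (h : C.hend r = C.start u), C.HasContent i r c →
        C.HasContent i (C.act r u h) (c + a.toAdd)}) where
  nonempty_harr r := ⟨_, .leaf r⟩
  nonempty_arr u := ⟨.ofAdd (.single (i (.inr u))), fun _ _ h hr => .act u h hr⟩
  mul_mem u v h a ha b hb r c hr hc := by
    rw [← C.act_comp r u v (hr.trans (C.start_comp u v h)) h, toAdd_mul, ← add_assoc]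
    exact hb _ _ _ (ha _ _ _ hc)
  act_mem r u h k hk a ha := ha r k h hk
  add_mem r s k hk l hl := .add hk hl
  ins_mem r u k hk a ha s c hs hc := by
    rw [C.act_ins s u r (hs.trans (C.start_ins u r))]
    change C.HasContent i _ (c + (a.toAdd + k))
    rw [← add_assoc]
    exact .add (ha _ _ _ hc) hk
  disjoint_arr u v hs ht hne := by
    -- By faithfulness it suffices to compare the arrows on each r; testing a common cover on the
    -- one-leaf forest r gives two forests with equal content.
    refine Set.disjoint_left.mpr fun a ha hb => hne (C.faithful u v hs ht fun r h => ?_)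
    exact (ha r _ h (.leaf r)).eq_of_hend_eq hO hL hA hI hi (hb r _ (h.trans hs) (.leaf r))
      (by rw [C.hend_act, C.hend_act, ht])
  disjoint_harr r s h hne :=
    Set.disjoint_left.mpr fun _ hr hs => hne (HasContent.eq_of_hend_eq hO hL hA hI hi hr hs h)

end Content

end ForestCategory

theorem mainTheorem2 {Obj : Type u₁} {HArr : Type u₂} {Arr : Type u₃}
    [AddCommMonoid Obj] [AddCommMonoid HArr] [Finite HArr] [Finite Arr]
    (C : ForestCategory Obj HArr Arr) (hO : ∀ x : Obj, x + x = x) :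
    ForestCategory.GloballyIdempotentCommutative.{w} C ↔
      C.LoopRemoval ∧ C.HorizontalAbsorption hO ∧ C.HorizontalIdempotence := by
  constructor
  · rintro ⟨H, _, hH, K, L, hD⟩
    exact ⟨hD.loopRemoval hH, hD.horizontalAbsorption hO hH, hD.horizontalIdempotence hO hH⟩
  · rintro ⟨hL, hA, hI⟩
    -- Finiteness allows the labels to be renamed into any universe.
    have : Small.{w} (HArr ⊕ Arr) := Countable.toSmall _
    exact ⟨LabelSet (Shrink.{w} (HArr ⊕ Arr)), inferInstance, LabelSet.add_self, _, _,
      ForestCategory.isDivision_hasContent hO hL hA hI (equivShrink.{w} (HArr ⊕ Arr)).injective⟩
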